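/- Theorem 5.1 (Kirchhoff index of $L_n$). For an integer $n\ge 0$ let $L_n$ be the linear hexagonal chain with $n$ hexagons, that is, the graph with the $4n+2$ vertices $p_0,\dots,p_n$, $q_0,\dots,q_n$, $u_0,\dots,u_{n-1}$, $v_0,\dots,v_{n-1}$ and the $5n+1$ edges $p_iq_i$ ($0\le i\le n$) and $p_iu_i$, $u_ip_{i+1}$, $q_iv_i$, $v_iq_{i+1}$ ($0\le i\le n-1$); thus $L_0$ is a single edge. For vertices $a,b$ of a connected graph $G$ let $r_G(a,b)$ be the resistance distance, that is, the potential difference between $a$ and $b$ when every edge of $G$ is a unit resistor and a unit current enters at $a$ and leaves at $b$, and let $Kf(G)=\sum_{\{a,b\}\subseteq V_G} r_G(a,b)$ (the sum over unordered pairs of distinct vertices) be the Kirchhoff index of $G$. Put $\alpha=3-2\sqrt2$. Then for every integer $n\ge 0$ $$Kf(L_n)=\frac{(1+2n)\bigl(21-6\sqrt2+2(8+9\sqrt2)n-\alpha^{2n+2}\,(21+6\sqrt2+2(8-9\sqrt2)n)\bigr)}{12\,(1-\alpha^{2n+2})}+\frac43(1+2n)n^2 .$$ -/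

import Mathlib

/-- `f` is an electric potential on the network obtained from `G` by replacing every edge by a
unit resistor, when a unit current enters the network at `a` and leaves it at `b`. By Ohm's law the
current from `x` to a neighbour `y` is `f x - f y`, and by Kirchhoff's current law the net current
out of `x` is the current supplied at `x` from outside. Equivalently `L f = e_a - e_b` with `L` the
Laplacian of `G`. -/
def IsUnitCurrentPotential {V : Type*} [Fintype V] (G : SimpleGraph V) (a b : V) (f : V → ℝ) :
    Prop :=
  open Classical in
  ∀ x, ∑ y, (if G.Adj x y then f x - f y else 0) =
    (if x = a then 1 else 0) - (if x = b then 1 else 0)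

/-- The potential difference between source and sink does not depend on the potential chosen. -/
theorem IsUnitCurrentPotential.sub_eq_sub {V : Type*} [Fintype V] {G : SimpleGraph V} {a b : V}
    {f g : V → ℝ} (hf : IsUnitCurrentPotential G a b f) (hg : IsUnitCurrentPotential G a b g) :
    f a - f b = g a - g b := by
  classical
  have key : ∀ h k : V → ℝ, ∑ x, h x * ∑ y, (if G.Adj x y then k x - k y else 0) =
      ∑ x, ∑ y, (if G.Adj x y then h x * k x - h x * k y else 0) := by
    intro h k
    refine Finset.sum_congr rfl fun x _ => ?_
    rw [Finset.mul_sum]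
    refine Finset.sum_congr rfl fun y _ => ?_
    split_ifs <;> ring
  have sym : ∑ x, g x * ∑ y, (if G.Adj x y then f x - f y else 0) =
      ∑ x, f x * ∑ y, (if G.Adj x y then g x - g y else 0) := by
    rw [key, key, ← sub_eq_zero, ← Finset.sum_sub_distrib]
    simp_rw [← Finset.sum_sub_distrib]
    have anti : ∀ x y : V, ((if G.Adj x y then g x * f x - g x * f y else 0) -
        (if G.Adj x y then f x * g x - f x * g y else 0) : ℝ) =
        (if G.Adj x y then f x * g y else 0) - (if G.Adj y x then f y * g x else 0) := by
      intro x y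
      simp only [G.adj_comm y x]
      split_ifs <;> ring
    simp_rw [anti, Finset.sum_sub_distrib]
    rw [sub_eq_zero]
    exact Finset.sum_comm
  unfold IsUnitCurrentPotential at hf hg
  have hl : ∀ h : V → ℝ,
      ∑ x, h x * ((if x = a then 1 else 0) - (if x = b then 1 else 0)) = h a - h b := by
    intro h
    simp [mul_sub, Finset.sum_sub_distrib]
  have e1 : ∑ x, g x * ∑ y, (if G.Adj x y then f x - f y else 0) = g a - g b := by
    rw [← hl g]
    exact Finset.sum_congr rfl fun x _ => by rw [← hf x]
  have e2 : ∑ x, f x * ∑ y, (if G.Adj x y then g x - g y else 0) = f a - f b := by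
    rw [← hl f]
    exact Finset.sum_congr rfl fun x _ => by rw [← hg x]
  rw [← e1, ← e2, sym]

theorem IsUnitCurrentPotential.neg {V : Type*} [Fintype V] {G : SimpleGraph V} {a b : V}
    {f : V → ℝ} (hf : IsUnitCurrentPotential G a b f) :
    IsUnitCurrentPotential G b a (fun x => -f x) := by
  classical
  intro x
  have h := hf x
  rw [← neg_sub, ← h, ← Finset.sum_neg_distrib]
  refine Finset.sum_congr rfl fun y _ => ?_
  split_ifs <;> ring

/-- In a connected network every pair of vertices admits such a potential. -/
theorem exists_isUnitCurrentPotential {V : Type*} [Fintype V] {G : SimpleGraph V}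
    (hG : G.Connected) (a b : V) : ∃ f, IsUnitCurrentPotential G a b f := by
  classical
  have hN : (Fintype.card V : ℝ) ≠ 0 := by
    have : Nonempty V := ⟨a⟩
    exact_mod_cast Fintype.card_ne_zero
  have hL : ∀ (f : V → ℝ) (x : V),
      (G.lapMatrix ℝ).mulVec f x = ∑ y, (if G.Adj x y then f x - f y else 0) := by
    intro f x
    rw [SimpleGraph.lapMatrix_mulVec_apply, ← Finset.sum_filter, Finset.sum_sub_distrib,
      Finset.sum_const, nsmul_eq_mul, ← SimpleGraph.neighborFinset_eq_filter,
      SimpleGraph.card_neighborFinset_eq_degree]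
  have hsum : ∀ f : V → ℝ, ∑ x, (G.lapMatrix ℝ).mulVec f x = 0 := by
    intro f
    simp_rw [hL]
    have h : ∑ x, ∑ y, (if G.Adj x y then f x - f y else 0) =
        -∑ x, ∑ y, (if G.Adj x y then f x - f y else 0) := by
      conv_lhs => rw [Finset.sum_comm]
      simp_rw [← Finset.sum_neg_distrib]
      refine Finset.sum_congr rfl fun x _ => Finset.sum_congr rfl fun y _ => ?_
      simp only [G.adj_comm y x]
      split_ifs <;> ring
    linarith
  let T : (V → ℝ) →ₗ[ℝ] (V → ℝ) :=
    Matrix.toLin' (G.lapMatrix ℝ) + LinearMap.pi fun _ => ∑ y, LinearMap.proj y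
  have hT : ∀ f x, T f x = (G.lapMatrix ℝ).mulVec f x + ∑ y, f y := by
    intro f x
    simp [T, Matrix.toLin'_apply]
  have hTsum : ∀ f, ∑ x, T f x = Fintype.card V * ∑ y, f y := by
    intro f
    simp_rw [hT, Finset.sum_add_distrib, hsum]
    simp
  have hinj : Function.Injective T := by
    rw [← LinearMap.ker_eq_bot, LinearMap.ker_eq_bot']
    intro f hf
    have h0 : ∑ y, f y = 0 := by
      have h := hTsum f
      rw [hf] at h
      simpa [hN] using h.symm
    have h1 : (G.lapMatrix ℝ).mulVec f = 0 := by
      funext x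
      have h := hT f x
      rw [hf, h0] at h
      simpa using h.symm
    rw [SimpleGraph.lapMatrix_mulVec_eq_zero_iff_forall_reachable] at h1
    funext x
    have h2 : ∑ y, f y = Fintype.card V * f x := by
      rw [Finset.sum_congr rfl fun y _ => h1 y x (hG.preconnected y x)]
      simp
    rw [h0] at h2
    simpa [hN] using h2.symm
  obtain ⟨f, hf⟩ := (LinearMap.injective_iff_surjective.mp hinj)
    (fun x => (if x = a then 1 else 0) - (if x = b then 1 else 0))
  have h0 : ∑ y, f y = 0 := by
    have h := hTsum f
    rw [hf] at h
    simpa [hN] using h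
  refine ⟨f, fun x => ?_⟩
  have h := hT f x
  rw [hf, h0, hL, add_zero] at h
  convert h.symm

open Classical in
/-- The resistance distance (effective resistance) between `a` and `b` in the network of unit
resistors on the edges of `G`: the potential difference between `a` and `b` when a unit current
enters at `a` and leaves at `b`. (The value is `0` if there is no such current, that is, if `a` and
`b` lie in different components.) -/
noncomputable def resistanceDistance {V : Type*} [Fintype V] (G : SimpleGraph V) (a b : V) : ℝ :=
  if h : ∃ f, IsUnitCurrentPotential G a b f then h.choose a - h.choose b else 0

theorem IsUnitCurrentPotential.resistanceDistance_eq {V : Type*} [Fintype V] {G : SimpleGraph V}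
    {a b : V} {f : V → ℝ} (hf : IsUnitCurrentPotential G a b f) :
    resistanceDistance G a b = f a - f b := by
  have h : ∃ f, IsUnitCurrentPotential G a b f := ⟨f, hf⟩
  rw [resistanceDistance, dif_pos h]
  exact h.choose_spec.sub_eq_sub hf

theorem resistanceDistance_comm {V : Type*} [Fintype V] (G : SimpleGraph V) (a b : V) :
    resistanceDistance G a b = resistanceDistance G b a := by
  by_cases h : ∃ f, IsUnitCurrentPotential G a b f
  · obtain ⟨f, hf⟩ := h
    rw [hf.resistanceDistance_eq, hf.neg.resistanceDistance_eq]
    ring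
  · have h' : ¬ ∃ f, IsUnitCurrentPotential G b a f := fun ⟨f, hf⟩ => h ⟨_, hf.neg⟩
    rw [resistanceDistance, resistanceDistance, dif_neg h, dif_neg h']

open Classical in
/-- The Kirchhoff index: the sum of the resistance distances over all unordered pairs of distinct
vertices. -/
noncomputable def kirchhoffIndex {V : Type*} [Fintype V] (G : SimpleGraph V) : ℝ :=
  ∑ e : Sym2 V with ¬ e.IsDiag, Sym2.lift ⟨resistanceDistance G, resistanceDistance_comm G⟩ e

/-- The vertices `p_0, …, p_n`, `q_0, …, q_n`, `u_0, …, u_{n-1}`, `v_0, …, v_{n-1}` of the linear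
hexagonal chain with `n` hexagons. -/
inductive HexVertex (n : ℕ) : Type
  | p (i : Fin (n + 1))
  | q (i : Fin (n + 1))
  | u (i : Fin n)
  | v (i : Fin n)
  deriving DecidableEq, Fintype

/-- The linear hexagonal chain `L_n`: its hexagons are the `n` cycles
`p_i, u_i, p_{i+1}, q_{i+1}, v_i, q_i` with `0 ≤ i < n`, consecutive ones sharing the edge
`p_{i+1} q_{i+1}`. So the edges are `p_i q_i` for `0 ≤ i ≤ n` and `p_i u_i`, `u_i p_{i+1}`,
`q_i v_i`, `v_i q_{i+1}` for `0 ≤ i < n`. -/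
def linearHexagonalChain (n : ℕ) : SimpleGraph (HexVertex n) :=
  SimpleGraph.fromRel fun
    | .p i, .q j => i = j
    | .p i, .u j => i = j.castSucc ∨ i = j.succ
    | .q i, .v j => i = j.castSucc ∨ i = j.succ
    | _, _ => False

/-!
The chain is a pair of paths `p_0, u_0, p_1, …, p_n` and `q_0, v_0, q_1, …, q_n` joined by rungs at
the even positions `0, 2, …, 2 * n`. Exchanging the two paths is a symmetry, so the Laplacian splits
(`laplacian_linearHexagonalChain`) into a symmetric part, the Laplacian of the path on `2 * n + 1`
vertices, and an antisymmetric part, the same Laplacian plus a weight `2` at the even positions.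

If the columns of a matrix `M` are potentials of unit currents that enter at the respective vertex
and leave along a fixed distribution, then `r(a, b) = M a a + M b b - M a b - M b a`, and the
Kirchhoff index is `|V| * tr M - ∑ M a b` (`kirchhoffIndex_eq_of_green`). Such an `M` is assembled
from Green's functions of the two parts. For the symmetric part it is `-|i - j| / 2`
(`pathLaplacian_dist`). For the antisymmetric part it is
`φ (min i j) * φ (2 * n - max i j) / W`, where `φ` solves the homogeneous equation from the left end
and `W` is the discrete Wronskian (`pathLaplacian_pathGreen`). The symmetric part contributes the
cubic `((2n + 1)³ - (2n + 1)) / 3` and the antisymmetric part `2 (2n + 1)` times the trace of its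
Green's function (`kirchhoffIndex_linearHexagonalChain`).

Eliminating every second position turns the recursion for `φ` into one with constant coefficients
and characteristic roots `3 ± 2√2`, so `φ` is explicit (`pathSolution_rungWeight`), the trace is a
sum of two convolutions of geometric sequences (`sum_convolution`), and simplifying with
`√2 ^ 2 = 2` gives the closed form (`sum_pathGreen_rungWeight`).
-/

/-! ### Kirchhoff index from a Green's function -/

/-- Each unordered pair of distinct vertices is counted twice by the double sum; the diagonal terms
vanish. -/
theorem two_mul_kirchhoffIndex {V : Type*} [Fintype V] (G : SimpleGraph V) :
    2 * kirchhoffIndex G = ∑ a, ∑ b, resistanceDistance G a b := by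
  classical
  let _ : LinearOrder V := LinearOrder.lift' (Fintype.equivFin V) (Fintype.equivFin V).injective
  have hdiag : ∀ a, resistanceDistance G a a = 0 := fun a => by
    have h : IsUnitCurrentPotential G a a 0 := fun x => by simp
    simp [h.resistanceDistance_eq]
  have hK : kirchhoffIndex G = ∑ x : V × V with x.1 < x.2, resistanceDistance G x.1 x.2 := by
    have h := Finset.sum_sym2_filter_not_isDiag (Finset.univ : Finset V)
      (Sym2.lift ⟨resistanceDistance G, resistanceDistance_comm G⟩)
    simp only [Finset.sym2_univ, Sym2.lift_mk] at h
    unfold kirchhoffIndex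
    convert h using 1
    · exact Finset.sum_congr (by ext; simp) fun _ _ => rfl
    · refine Finset.sum_congr ?_ fun _ _ => rfl
      ext ⟨x, y⟩
      simpa using fun h : x < y => h.ne
  have hswap : ∑ x : V × V with x.2 < x.1, resistanceDistance G x.1 x.2 =
      ∑ x : V × V with x.1 < x.2, resistanceDistance G x.1 x.2 := by
    refine Finset.sum_equiv (Equiv.prodComm V V) (by simp) fun x _ => ?_
    exact resistanceDistance_comm G _ _
  calc 2 * kirchhoffIndex G
      = ∑ x : V × V with x.1 < x.2, resistanceDistance G x.1 x.2 +
          ∑ x : V × V with x.2 < x.1, resistanceDistance G x.1 x.2 := by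
        rw [hswap, hK, two_mul]
    _ = ∑ x : V × V, resistanceDistance G x.1 x.2 := by
        rw [Finset.sum_filter, Finset.sum_filter, ← Finset.sum_add_distrib]
        refine Finset.sum_congr rfl fun x _ => ?_
        rcases lt_trichotomy x.1 x.2 with h | h | h
        · simp [h, h.not_gt]
        · simp [h, hdiag]
        · simp [h, h.not_gt]
    _ = ∑ a, ∑ b, resistanceDistance G a b := Fintype.sum_prod_type _

/-- A Green's function `M` of the network (the column `M · b` is the potential of a unit current
entering at `b` and leaving along a distribution `c` that does not depend on `b`) determines all
resistance distances, hence the Kirchhoff index. -/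
theorem kirchhoffIndex_eq_of_green {V : Type*} [Fintype V] [DecidableEq V] (G : SimpleGraph V)
    [DecidableRel G.Adj] (M : V → V → ℝ) (c : V → ℝ)
    (hM : ∀ b x, ∑ y, (if G.Adj x y then M x b - M y b else 0) = (if x = b then 1 else 0) - c x) :
    kirchhoffIndex G = Fintype.card V * ∑ a, M a a - ∑ a, ∑ b, M a b := by
  have hr : ∀ a b, resistanceDistance G a b = M a a + M b b - M a b - M b a := by
    intro a b
    have h : IsUnitCurrentPotential G a b fun x => M x a - M x b := by
      intro x
      have h1 := hM a x
      have h2 := hM b x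
      have h3 : ∀ y, (if G.Adj x y then (M x a - M x b) - (M y a - M y b) else 0) =
          (if G.Adj x y then M x a - M y a else 0) - (if G.Adj x y then M x b - M y b else 0) := by
        intro y
        split_ifs <;> ring
      trans ∑ y, (if G.Adj x y then (M x a - M x b) - (M y a - M y b) else 0)
      · exact Finset.sum_congr rfl fun y _ => by congr
      · simp_rw [h3]
        rw [Finset.sum_sub_distrib, h1, h2]
        ring_nf
    rw [h.resistanceDistance_eq]
    ring
  have h := two_mul_kirchhoffIndex G
  simp_rw [hr, Finset.sum_sub_distrib, Finset.sum_add_distrib] at h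
  rw [Finset.sum_comm (f := fun a b => M b a)] at h
  simp only [Finset.sum_const, Finset.card_univ, nsmul_eq_mul, ← Finset.mul_sum] at h
  linarith

/-! ### Green's functions on a path -/

/-- The Laplacian of the path with vertices `0, …, m`, applied to `f`. -/
def pathLaplacian (m : ℕ) (f : ℕ → ℝ) (i : ℕ) : ℝ :=
  (if i < m then f i - f (i + 1) else 0) + (if 0 < i then f i - f (i - 1) else 0)

/-- The solution of `(pathLaplacian + w) f = 0` to the right of the left end, moved by one place so
that the reflecting boundary condition is `f 0 = f 1`: the value at vertex `i` is
`pathSolution w (i + 1)`. -/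
def pathSolution (w : ℕ → ℝ) : ℕ → ℝ
  | 0 => 1
  | 1 => 1
  | i + 2 => (2 + w i) * pathSolution w (i + 1) - pathSolution w i

theorem pathSolution_add_two (w : ℕ → ℝ) (i : ℕ) :
    pathSolution w (i + 2) = (2 + w i) * pathSolution w (i + 1) - pathSolution w i := rfl

/-- The discrete Wronskian of the left solution and its mirror image is constant along the path. -/
theorem pathSolution_wronskian {w : ℕ → ℝ} {m : ℕ} (hw : ∀ i k, i + k = m → w i = w k) (i k : ℕ)
    (h : i + k = m) :
    pathSolution w (i + 2) * pathSolution w (k + 1) - pathSolution w (i + 1) * pathSolution w k =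
      pathSolution w (m + 2) - pathSolution w (m + 1) := by
  induction k generalizing i with
  | zero =>
    obtain rfl : i = m := by omega
    simp [pathSolution]
  | succ k ih =>
    rw [← ih (i + 1) (by omega), pathSolution_add_two w (i + 1), pathSolution_add_two w k,
      hw (i + 1) k (by omega)]
    ring_nf

theorem pathSolution_pos_and_lt {w : ℕ → ℝ} (hw : ∀ i, 0 ≤ w i) (h0 : 0 < w 0) (i : ℕ) :
    0 < pathSolution w (i + 1) ∧ pathSolution w (i + 1) < pathSolution w (i + 2) := by
  induction i with
  | zero => simpa [pathSolution] using by linarith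
  | succ i ih =>
    have h := mul_nonneg (hw (i + 1)) (ih.1.trans ih.2).le
    refine ⟨ih.1.trans ih.2, ?_⟩
    rw [pathSolution_add_two w (i + 1)]
    linarith [ih.2]

/-- The Green's function of `pathLaplacian m + w` for a weight `w` that is invariant under the
reflection `i ↦ m - i`. -/
noncomputable def pathGreen (w : ℕ → ℝ) (m i j : ℕ) : ℝ :=
  pathSolution w (min i j + 1) * pathSolution w (m - max i j + 1) /
    (pathSolution w (m + 2) - pathSolution w (m + 1))

/-- Off the diagonal both factors of `pathGreen` solve the homogeneous equation; on the diagonal the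
jump of the slope is the Wronskian, which the denominator normalizes to `1`. -/
theorem pathLaplacian_pathGreen {w : ℕ → ℝ} {m : ℕ} (hw : ∀ i k, i + k = m → w i = w k)
    (hW : pathSolution w (m + 2) - pathSolution w (m + 1) ≠ 0) {i j : ℕ} (hi : i ≤ m)
    (hj : j ≤ m) :
    pathLaplacian m (fun x => pathGreen w m x j) i + w i * pathGreen w m i j =
      if i = j then 1 else 0 := by
  set W := pathSolution w (m + 2) - pathSolution w (m + 1) with hWdef
  have left : i ≤ j → (if 0 < i then pathGreen w m i j - pathGreen w m (i - 1) j else 0) =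
      (pathSolution w (i + 1) - pathSolution w i) * pathSolution w (m - j + 1) / W := by
    intro hij
    rcases i with _ | i
    · simp [pathSolution]
    · simp only [pathGreen, Nat.succ_pos, if_true, Nat.add_sub_cancel, min_eq_left hij,
        max_eq_right hij, min_eq_left (Nat.le_of_succ_le hij),
        max_eq_right (Nat.le_of_succ_le hij)]
      ring
  have right : j ≤ i → (if i < m then pathGreen w m i j - pathGreen w m (i + 1) j else 0) =
      pathSolution w (j + 1) * (pathSolution w (m - i + 1) - pathSolution w (m - i)) / W := by
    intro hij
    rcases hi.eq_or_lt with rfl | him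
    · simp [pathSolution]
    · have e : m - (i + 1) + 1 = m - i := by omega
      simp only [pathGreen, if_pos him, min_eq_right hij, max_eq_left hij,
        min_eq_right (Nat.le_succ_of_le hij), max_eq_left (Nat.le_succ_of_le hij), e]
      ring
  unfold pathLaplacian
  rcases lt_trichotomy i j with hij | rfl | hij
  · rw [left hij.le, if_pos (by omega), if_neg hij.ne]
    simp only [pathGreen, min_eq_left hij.le, max_eq_right hij.le,
      min_eq_left (Nat.succ_le_of_lt hij), max_eq_right (Nat.succ_le_of_lt hij)]
    rw [pathSolution_add_two w i]
    ring
  · rw [left le_rfl, right le_rfl, if_pos rfl]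
    have h := pathSolution_wronskian hw i (m - i) (by omega)
    rw [pathSolution_add_two, ← hWdef] at h
    simp only [pathGreen, min_self, max_self]
    rw [← hWdef]
    field_simp
    rw [← h]
    ring
  · obtain ⟨k, hk⟩ : ∃ k, m = i + k := ⟨m - i, by omega⟩
    have e1 : m - i = k := by omega
    have e2 : m - (i - 1) = k + 1 := by omega
    have h1 : min (i - 1) j = j := by omega
    have h2 : max (i - 1) j = i - 1 := by omega
    rw [right hij.le, if_pos (by omega), if_neg hij.ne', hw i k hk.symm]
    simp only [pathGreen, min_eq_right hij.le, max_eq_left hij.le, h1, h2, e1, e2]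
    rw [pathSolution_add_two w k]
    ring

/-- For the path Laplacian itself, whose kernel consists of the constants, `-|i - j| / 2` is a
Green's function with the current leaving in equal parts at the two ends. -/
theorem pathLaplacian_dist {m i j : ℕ} (hi : i ≤ m) (hj : j ≤ m) :
    pathLaplacian m (fun x => -|(x : ℝ) - j| / 2) i =
      (if i = j then 1 else 0) - ((if i = m then 1 / 2 else 0) + (if i = 0 then 1 / 2 else 0)) := by
  have up : (if i < m then -|(i : ℝ) - j| / 2 - -|((i + 1 : ℕ) : ℝ) - j| / 2 else 0) =
      (if j ≤ i then 1 / 2 else -1 / 2) - (if i = m then (1 / 2 : ℝ) else 0) := by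
    rcases hi.eq_or_lt with rfl | him
    · simp [hj]
    · rw [if_pos him, if_neg him.ne]
      split_ifs with h
      · have h' : (j : ℝ) ≤ i := by exact_mod_cast h
        push_cast
        rw [abs_of_nonneg (by linarith), abs_of_nonneg (by linarith)]
        ring
      · have h' : (i : ℝ) + 1 ≤ j := by exact_mod_cast not_le.1 h
        push_cast
        rw [abs_of_nonpos (by linarith), abs_of_nonpos (by linarith)]
        ring
  have down : (if 0 < i then -|(i : ℝ) - j| / 2 - -|((i - 1 : ℕ) : ℝ) - j| / 2 else 0) =
      (if i ≤ j then 1 / 2 else -1 / 2) - (if i = 0 then (1 / 2 : ℝ) else 0) := by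
    rcases i with _ | i
    · simp
    · rw [if_pos (Nat.succ_pos i), if_neg (Nat.succ_ne_zero i), Nat.add_sub_cancel]
      split_ifs with h
      · have h' : (i : ℝ) + 1 ≤ j := by exact_mod_cast h
        push_cast
        rw [abs_of_nonpos (by linarith), abs_of_nonpos (by linarith)]
        ring
      · have h' : (j : ℝ) ≤ i := by exact_mod_cast Nat.lt_succ_iff.1 (not_le.1 h)
        push_cast
        rw [abs_of_nonneg (by linarith), abs_of_nonneg (by linarith)]
        ring
  unfold pathLaplacian
  rw [up, down]
  have key : ((if j ≤ i then 1 / 2 else -1 / 2) + (if i ≤ j then 1 / 2 else -1 / 2) : ℝ) =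
      if i = j then 1 else 0 := by
    rcases lt_trichotomy i j with h | rfl | h
    · rw [if_neg (by omega), if_pos h.le, if_neg h.ne]; norm_num
    · norm_num
    · rw [if_pos h.le, if_neg (by omega), if_neg h.ne']; norm_num
  rw [← key]
  ring

theorem sum_range_abs_sub (m : ℕ) :
    ∑ i ∈ Finset.range m, ∑ j ∈ Finset.range m, |(i : ℝ) - j| = ((m : ℝ) ^ 3 - m) / 3 := by
  have h : ∀ m : ℕ, ∑ i ∈ Finset.range m, |(i : ℝ) - m| = (m : ℝ) * (m + 1) / 2 := by
    intro m
    have h1 : ∀ i ∈ Finset.range m, |(i : ℝ) - m| = m - i := by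
      intro i hi
      have : (i : ℝ) ≤ m := by exact_mod_cast (Finset.mem_range.1 hi).le
      rw [abs_of_nonpos (by linarith)]
      ring
    have h2 : ∀ m : ℕ, ∑ i ∈ Finset.range m, (i : ℝ) = m * (m - 1) / 2 := by
      intro m
      induction m with
      | zero => simp
      | succ m ih => rw [Finset.sum_range_succ, ih]; push_cast; ring
    rw [Finset.sum_congr rfl h1, Finset.sum_sub_distrib, h2]
    simp
    ring
  induction m with
  | zero => simp
  | succ m ih =>
    simp_rw [Finset.sum_range_succ _ m]
    rw [Finset.sum_add_distrib, ih, h]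
    simp_rw [abs_sub_comm (m : ℝ)]
    rw [h]
    simp
    ring

theorem sum_range_two_mul_add_one (n : ℕ) (g : ℕ → ℝ) :
    ∑ i ∈ Finset.range (2 * n + 1), g i =
      ∑ i ∈ Finset.range (n + 1), g (2 * i) + ∑ i ∈ Finset.range n, g (2 * i + 1) := by
  induction n with
  | zero => simp
  | succ n ih =>
    rw [show 2 * (n + 1) + 1 = 2 * n + 1 + 1 + 1 by ring, Finset.sum_range_succ,
      Finset.sum_range_succ, ih, Finset.sum_range_succ _ (n + 1),
      Finset.sum_range_succ (fun i => g (2 * i + 1)) n, show 2 * n + 1 + 1 = 2 * (n + 1) by ring]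
    ring

/-! ### The hexagonal chain as two coupled paths -/

namespace HexVertex

/-- The position, from `0` to `2 * n`, of a vertex on its side
`p_0, u_0, p_1, …, p_n` or `q_0, v_0, q_1, …, q_n` of the chain. -/
def pos {n : ℕ} : HexVertex n → ℕ
  | p i => 2 * i
  | q i => 2 * i
  | u i => 2 * i + 1
  | v i => 2 * i + 1

/-- The side of a vertex: `1` on the path through the `p_i`, `-1` on the path through the `q_i`. -/
def side {n : ℕ} : HexVertex n → ℝ
  | p _ => 1
  | q _ => -1
  | u _ => 1
  | v _ => -1

theorem pos_le {n : ℕ} (x : HexVertex n) : x.pos ≤ 2 * n := by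
  cases x <;> simp only [pos] <;> omega

/-- The four families of vertices as a disjoint union. -/
def equivSum (n : ℕ) : HexVertex n ≃ (Fin (n + 1) ⊕ Fin (n + 1)) ⊕ (Fin n ⊕ Fin n) where
  toFun
    | p i => .inl (.inl i)
    | q i => .inl (.inr i)
    | u i => .inr (.inl i)
    | v i => .inr (.inr i)
  invFun
    | .inl (.inl i) => p i
    | .inl (.inr i) => q i
    | .inr (.inl i) => u i
    | .inr (.inr i) => v i
  left_inv x := by cases x <;> rfl
  right_inv x := by rcases x with (_ | _) | (_ | _) <;> rfl

theorem sum_eq {n : ℕ} (f : HexVertex n → ℝ) :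
    ∑ x, f x = (∑ i, f (p i) + ∑ i, f (q i)) + (∑ i, f (u i) + ∑ i, f (v i)) := by
  rw [← (equivSum n).symm.sum_comp]
  simp [Fintype.sum_sum_type, equivSum]

theorem card_eq (n : ℕ) : Fintype.card (HexVertex n) = 2 * (2 * n + 1) := by
  rw [Fintype.card_congr (equivSum n)]
  simp
  omega

theorem sum_comp_pos {n : ℕ} (g : ℕ → ℝ) :
    ∑ x : HexVertex n, g x.pos = 2 * ∑ i ∈ Finset.range (2 * n + 1), g i := by
  rw [sum_eq, sum_range_two_mul_add_one]
  simp only [pos, Finset.sum_range]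
  ring

theorem sum_side_mul_comp_pos {n : ℕ} (g : ℕ → ℝ) :
    ∑ x : HexVertex n, x.side * g x.pos = 0 := by
  rw [sum_eq]
  simp [pos, side]

/-- Two vertices coincide when position and side agree. -/
theorem half_one_add_side_mul_side {n : ℕ} (x a : HexVertex n) :
    (if x.pos = a.pos then (1 + x.side * a.side) / 2 else 0) = if x = a then 1 else 0 := by
  cases x <;> cases a <;> simp [pos, side, Fin.ext_iff] <;> omega

end HexVertex

/-- The contribution of the rungs `p_i q_i`, at the even positions `2 * i`, to the antisymmetric part
of the Laplacian: if the potentials of the two ends are `f` and `-f`, the current is `2 * f`. -/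
def rungWeight (i : ℕ) : ℝ := if Even i then 2 else 0

theorem pathLaplacian_add_mul (m : ℕ) (F H : ℕ → ℝ) (s : ℝ) (i : ℕ) :
    pathLaplacian m (fun j => F j + s * H j) i =
      pathLaplacian m F i + s * pathLaplacian m H i := by
  unfold pathLaplacian
  split_ifs <;> ring

theorem pathLaplacian_two_mul {n : ℕ} (i : Fin (n + 1)) (F : ℕ → ℝ) :
    pathLaplacian (2 * n) F (2 * i) =
      ∑ j : Fin n, (if i = j.castSucc ∨ i = j.succ then F (2 * i) - F (2 * j + 1) else 0) := by
  have h : ∀ j : Fin n,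
      (if i = j.castSucc ∨ i = j.succ then F (2 * i) - F (2 * j + 1) else 0) =
        (if (j : ℕ) = i then F (2 * i) - F (2 * i + 1) else 0) +
          (if (j : ℕ) + 1 = i then F (2 * i) - F (2 * i - 1) else 0) := by
    intro j
    simp only [Fin.ext_iff, Fin.val_castSucc, Fin.val_succ]
    by_cases h1 : (j : ℕ) = i
    · rw [if_pos (by omega), if_pos h1, if_neg (by omega), h1, add_zero]
    · by_cases h2 : (j : ℕ) + 1 = i
      · rw [if_pos (by omega), if_neg h1, if_pos h2, zero_add,
          show 2 * (i : ℕ) - 1 = 2 * j + 1 by omega]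
      · rw [if_neg (by omega), if_neg h1, if_neg h2, zero_add]
  simp_rw [h, Finset.sum_add_distrib]
  unfold pathLaplacian
  congr 1
  · rw [← Finset.sum_range (fun j => if j = (i : ℕ) then F (2 * i) - F (2 * i + 1) else 0)]
    simp
  · rw [← Finset.sum_range (fun j => if j + 1 = (i : ℕ) then F (2 * i) - F (2 * i - 1) else 0)]
    obtain ⟨_ | i, hi⟩ := i
    · simp
    · simp
      omega

theorem pathLaplacian_two_mul_add_one {n : ℕ} (j : Fin n) (F : ℕ → ℝ) :
    pathLaplacian (2 * n) F (2 * j + 1) =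
      ∑ i : Fin (n + 1),
        (if i = j.castSucc ∨ i = j.succ then F (2 * j + 1) - F (2 * i) else 0) := by
  have h : ∀ i : Fin (n + 1),
      (if i = j.castSucc ∨ i = j.succ then F (2 * j + 1) - F (2 * i) else 0) =
        (if i = j.succ then F (2 * j + 1) - F (2 * i) else 0) +
          (if i = j.castSucc then F (2 * j + 1) - F (2 * i) else 0) := by
    intro i
    by_cases h1 : i = j.castSucc
    · have h2 : i ≠ j.succ := by rw [h1]; exact Fin.castSucc_lt_succ.ne
      rw [if_pos (Or.inl h1), if_neg h2, if_pos h1, zero_add]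
    · simp [h1]
  simp_rw [h, Finset.sum_add_distrib]
  unfold pathLaplacian
  rw [if_pos (by omega), if_pos (by omega)]
  simp [mul_add]

/-- The Laplacian of the chain splits: on the part symmetric under exchange of the two sides it is
the path Laplacian, on the antisymmetric part it is the path Laplacian plus the rung weight. -/
theorem laplacian_linearHexagonalChain (n : ℕ) [DecidableRel (linearHexagonalChain n).Adj]
    (F H : ℕ → ℝ) (x : HexVertex n) :
    ∑ y, (if (linearHexagonalChain n).Adj x y then
        (F x.pos + x.side * H x.pos) - (F y.pos + y.side * H y.pos) else 0) =
      pathLaplacian (2 * n) F x.pos +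
        x.side * (pathLaplacian (2 * n) H x.pos + rungWeight x.pos * H x.pos) := by
  rw [HexVertex.sum_eq, mul_add, ← add_assoc (pathLaplacian _ _ _), ← pathLaplacian_add_mul]
  cases x with
  | p i =>
    rw [HexVertex.pos, pathLaplacian_two_mul]
    simp [linearHexagonalChain, HexVertex.pos, HexVertex.side, rungWeight]
    ring
  | q i =>
    rw [HexVertex.pos, pathLaplacian_two_mul]
    simp [linearHexagonalChain, HexVertex.pos, HexVertex.side, rungWeight]
    ring
  | u i =>
    rw [HexVertex.pos, pathLaplacian_two_mul_add_one]
    simp [linearHexagonalChain, HexVertex.pos, HexVertex.side, rungWeight]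
  | v i =>
    rw [HexVertex.pos, pathLaplacian_two_mul_add_one]
    simp [linearHexagonalChain, HexVertex.pos, HexVertex.side, rungWeight]

/-- The denominator of the antisymmetric Green's function does not vanish. -/
theorem rungWeight_wronskian_ne_zero (m : ℕ) :
    pathSolution rungWeight (m + 2) - pathSolution rungWeight (m + 1) ≠ 0 := by
  have hw0 : ∀ i, 0 ≤ rungWeight i := fun i => by unfold rungWeight; split_ifs <;> norm_num
  exact (sub_pos.2 (pathSolution_pos_and_lt hw0 (by simp [rungWeight]) m).2).ne'

theorem kirchhoffIndex_linearHexagonalChain (n : ℕ) :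
    kirchhoffIndex (linearHexagonalChain n) =
      2 * (2 * n + 1) * ∑ i ∈ Finset.range (2 * n + 1), pathGreen rungWeight (2 * n) i i +
        ((2 * (n : ℝ) + 1) ^ 3 - (2 * n + 1)) / 3 := by
  have hsym : ∀ i k, i + k = 2 * n → rungWeight i = rungWeight k := by
    intro i k h
    have : Even i ↔ Even k := by rw [← Nat.even_add, h]; exact even_two_mul n
    simp [rungWeight, this]
  have hW := rungWeight_wronskian_ne_zero (2 * n)
  classical
  rw [kirchhoffIndex_eq_of_green (linearHexagonalChain n)
    (fun x a => -|(x.pos : ℝ) - a.pos| / 2 / 2 +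
      x.side * (a.side * pathGreen rungWeight (2 * n) x.pos a.pos / 2))
    (fun x => ((if x.pos = 2 * n then 1 / 2 else 0) + (if x.pos = 0 then 1 / 2 else 0)) / 2)]
  · have hdiag : ∀ a : HexVertex n, -|(a.pos : ℝ) - a.pos| / 2 / 2 +
        a.side * (a.side * pathGreen rungWeight (2 * n) a.pos a.pos / 2) =
        pathGreen rungWeight (2 * n) a.pos a.pos / 2 := by
      intro a
      cases a <;> simp [HexVertex.side, neg_div]
    have hoff : ∀ a : HexVertex n, ∑ b : HexVertex n, (-|(a.pos : ℝ) - b.pos| / 2 / 2 +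
        a.side * (b.side * pathGreen rungWeight (2 * n) a.pos b.pos / 2)) =
        2 * ∑ j ∈ Finset.range (2 * n + 1), -|(a.pos : ℝ) - j| / 2 / 2 := by
      intro a
      have h0 := HexVertex.sum_side_mul_comp_pos (n := n)
        (fun j => pathGreen rungWeight (2 * n) a.pos j / 2)
      rw [Finset.sum_add_distrib, ← Finset.mul_sum,
        HexVertex.sum_comp_pos (fun j : ℕ => -|(a.pos : ℝ) - j| / 2 / 2)]
      simp_rw [mul_div_assoc]
      rw [h0, mul_zero, add_zero]
    simp_rw [hdiag, hoff]
    rw [HexVertex.sum_comp_pos (fun i => pathGreen rungWeight (2 * n) i i / 2),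
      HexVertex.sum_comp_pos
        (fun i => 2 * ∑ j ∈ Finset.range (2 * n + 1), -|(i : ℝ) - j| / 2 / 2), HexVertex.card_eq]
    simp_rw [← Finset.sum_div, Finset.sum_neg_distrib, ← Finset.mul_sum, ← Finset.sum_div,
      Finset.sum_neg_distrib]
    rw [sum_range_abs_sub]
    push_cast
    ring
  · intro a x
    have h := laplacian_linearHexagonalChain n (fun i => -|(i : ℝ) - a.pos| / 2 / 2)
      (fun i => a.side * pathGreen rungWeight (2 * n) i a.pos / 2) x
    have h1 := pathLaplacian_dist x.pos_le a.pos_le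
    have h2 := pathLaplacian_pathGreen hsym hW x.pos_le a.pos_le
    rw [h, ← HexVertex.half_one_add_side_mul_side]
    have e1 : pathLaplacian (2 * n) (fun i => -|(i : ℝ) - a.pos| / 2 / 2) x.pos =
        pathLaplacian (2 * n) (fun i => -|(i : ℝ) - a.pos| / 2) x.pos / 2 := by
      unfold pathLaplacian; split_ifs <;> ring
    have e2 : pathLaplacian (2 * n) (fun i => a.side * pathGreen rungWeight (2 * n) i a.pos / 2)
        x.pos = a.side / 2 *
          pathLaplacian (2 * n) (fun i => pathGreen rungWeight (2 * n) i a.pos) x.pos := by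
      unfold pathLaplacian; split_ifs <;> ring
    rw [e1, e2, h1]
    have h3 : (if x.pos = a.pos then (1 + x.side * a.side) / 2 else 0) =
        (1 + x.side * a.side) / 2 * (if x.pos = a.pos then 1 else 0) := by simp
    rw [h3]
    linear_combination x.side * a.side / 2 * h2

/-! ### Evaluation of the trace -/

/-- The convolution of `a β ^ k + b α ^ k` with itself, over `N` terms. For `N = 0` the truncated
exponent `N - 1` is harmless, as it comes with the factor `N`. -/
theorem sum_convolution {a b α β : ℝ} (h : β - α ≠ 0) (N : ℕ) :
    ∑ k ∈ Finset.range N, (a * β ^ k + b * α ^ k) * (a * β ^ (N - 1 - k) + b * α ^ (N - 1 - k)) =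
      N * (a ^ 2 * β ^ (N - 1) + b ^ 2 * α ^ (N - 1)) +
        2 * a * b * ((β ^ N - α ^ N) / (β - α)) := by
  have h1 := (Commute.all β α).geom_sum₂_mul N
  have h2 := (Commute.all α β).geom_sum₂_mul N
  have e : ∀ k ∈ Finset.range N,
      (a * β ^ k + b * α ^ k) * (a * β ^ (N - 1 - k) + b * α ^ (N - 1 - k)) =
        (a ^ 2 * β ^ (N - 1) + b ^ 2 * α ^ (N - 1)) + a * b * (β ^ k * α ^ (N - 1 - k)) +
          a * b * (α ^ k * β ^ (N - 1 - k)) := by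
    intro k hk
    have hk' : N - 1 = k + (N - 1 - k) := by have := Finset.mem_range.1 hk; omega
    have hb : β ^ (N - 1) = β ^ k * β ^ (N - 1 - k) := by rw [← pow_add, ← hk']
    have ha : α ^ (N - 1) = α ^ k * α ^ (N - 1 - k) := by rw [← pow_add, ← hk']
    rw [hb, ha]
    ring
  rw [Finset.sum_congr rfl e, Finset.sum_add_distrib, Finset.sum_add_distrib, ← Finset.mul_sum,
    ← Finset.mul_sum, Finset.sum_const, Finset.card_range, nsmul_eq_mul]
  rw [← eq_div_iff h] at h1
  have h' : α - β ≠ 0 := by rw [← neg_sub]; exact neg_ne_zero.2 h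
  rw [← eq_div_iff h', ← neg_div_neg_eq, neg_sub, neg_sub] at h2
  rw [h1, h2]
  ring

/-- The left solution for the rung weight runs through `1, 3, 5, 17, 29, 99, …`, given by the roots
`3 ± 2√2` of `t² - 6 t + 1`. -/
theorem pathSolution_rungWeight (k : ℕ) :
    pathSolution rungWeight (2 * k + 1) =
        (2 + √2) / 4 * (3 + 2 * √2) ^ k + (2 - √2) / 4 * (3 - 2 * √2) ^ k ∧
      pathSolution rungWeight (2 * k + 2) =
        (3 + 2 * √2) / 2 * (3 + 2 * √2) ^ k + (3 - 2 * √2) / 2 * (3 - 2 * √2) ^ k := by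
  have h2 : √2 ^ 2 = (2 : ℝ) := Real.sq_sqrt (by norm_num)
  induction k with
  | zero => constructor <;> norm_num [pathSolution, rungWeight] <;> ring
  | succ k ih =>
    have e1 : rungWeight (2 * k + 1) = 0 := by simp [rungWeight]
    have e2 : rungWeight (2 * k + 2) = 2 := by
      simp [rungWeight, show 2 * k + 2 = 2 * (k + 1) by ring]
    have s1 : pathSolution rungWeight (2 * k + 3) =
        (2 + √2) / 4 * (3 + 2 * √2) ^ (k + 1) + (2 - √2) / 4 * (3 - 2 * √2) ^ (k + 1) := by
      rw [pathSolution_add_two, e1, ih.1, ih.2, pow_succ, pow_succ]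
      linear_combination (-(3 + 2 * √2) ^ k / 2 - (3 - 2 * √2) ^ k / 2) * h2
    refine ⟨s1, ?_⟩
    rw [show 2 * (k + 1) + 2 = 2 * k + 2 + 2 by ring, pathSolution_add_two, e2,
      show 2 * k + 2 + 1 = 2 * k + 3 by ring, s1, ih.2]
    simp only [pow_succ]
    ring

/-- The trace of the antisymmetric Green's function. -/
theorem sum_pathGreen_rungWeight (n : ℕ) :
    ∑ i ∈ Finset.range (2 * n + 1), pathGreen rungWeight (2 * n) i i =
      (21 - 6 * √2 + 2 * (8 + 9 * √2) * n -
        (3 - 2 * √2) ^ (2 * n + 2) * (21 + 6 * √2 + 2 * (8 - 9 * √2) * n)) /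
          (24 * (1 - (3 - 2 * √2) ^ (2 * n + 2))) - 2 / 3 * n := by
  have h2 : √2 ^ 2 = (2 : ℝ) := Real.sq_sqrt (by norm_num)
  have hr : √2 ≠ 0 := by positivity
  have hodd := fun k => (pathSolution_rungWeight k).1
  have heven := fun k => (pathSolution_rungWeight k).2
  have hW := rungWeight_wronskian_ne_zero (2 * n)
  have htrace : ∑ i ∈ Finset.range (2 * n + 1), pathGreen rungWeight (2 * n) i i =
      (∑ k ∈ Finset.range (n + 1), pathSolution rungWeight (2 * k + 1) *
          pathSolution rungWeight (2 * (n + 1 - 1 - k) + 1) +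
        ∑ k ∈ Finset.range n, pathSolution rungWeight (2 * k + 2) *
          pathSolution rungWeight (2 * (n - 1 - k) + 2)) /
        (pathSolution rungWeight (2 * n + 2) - pathSolution rungWeight (2 * n + 1)) := by
    simp only [pathGreen, min_self, max_self]
    rw [← Finset.sum_div, sum_range_two_mul_add_one]
    congr 2
    · refine Finset.sum_congr rfl fun k _ => ?_
      rw [show 2 * n - 2 * k = 2 * (n + 1 - 1 - k) by omega]
    · refine Finset.sum_congr rfl fun k hk => ?_
      have := Finset.mem_range.1 hk
      rw [show 2 * n - (2 * k + 1) + 1 = 2 * (n - 1 - k) + 2 by omega]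
  rw [htrace]
  simp only [hodd, heven] at hW ⊢
  generalize √2 = r at *
  have hβα : (3 + 2 * r) - (3 - 2 * r) ≠ 0 := by
    intro h
    exact hr (by linarith)
  -- The difference of the roots is `4√2`, and `1 / (4√2) = √2 / 8`.
  have hinv : ∀ x : ℝ, x / ((3 + 2 * r) - (3 - 2 * r)) = x * (r / 8) := by
    intro x
    rw [div_eq_iff hβα]
    linear_combination -x / 2 * h2
  have hXY : (3 - 2 * r) ^ n * (3 + 2 * r) ^ n = 1 := by
    rw [← mul_pow, show (3 - 2 * r) * (3 + 2 * r) = 1 by linear_combination -4 * h2, one_pow]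
  have hpred : ∀ x : ℝ, (n : ℝ) * x ^ (n - 1) * x = n * x ^ n := by
    intro x
    rcases n with _ | n
    · simp
    · rw [Nat.add_sub_cancel, pow_succ]; ring
  have hpX := hpred (3 - 2 * r)
  have hpY := hpred (3 + 2 * r)
  rw [sum_convolution hβα, sum_convolution hβα, hinv, hinv, Nat.add_sub_cancel,
    show (3 - 2 * r) ^ (2 * n + 2) = (3 - 2 * r) ^ 2 * ((3 - 2 * r) ^ n) ^ 2 by ring,
    pow_succ (3 + 2 * r) n, pow_succ (3 - 2 * r) n]
  push_cast
  generalize (3 - 2 * r) ^ n = X at *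
  generalize (3 + 2 * r) ^ n = Y at *
  generalize (3 - 2 * r) ^ (n - 1) = X' at *
  generalize (3 + 2 * r) ^ (n - 1) = Y' at *
  have hX : X ^ 2 * Y = X := by linear_combination X * hXY
  -- `α² = -(4 - 3√2) / (4 + 3√2)`, so the Wronskian is a multiple of `1 - α ^ (2 * n + 2)`.
  have hWr : (3 + 2 * r) / 2 * Y + (3 - 2 * r) / 2 * X - ((2 + r) / 4 * Y + (2 - r) / 4 * X) =
      (4 + 3 * r) * Y / 4 * (1 - (3 - 2 * r) ^ 2 * X ^ 2) := by
    grind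
  have hD : 1 - (3 - 2 * r) ^ 2 * X ^ 2 ≠ 0 := by
    intro h
    rw [hWr, h, mul_zero] at hW
    exact hW rfl
  have hn : (n : ℝ) * (((3 + 2 * r) / 2) ^ 2 * Y' + ((3 - 2 * r) / 2) ^ 2 * X') =
      n * ((3 + 2 * r) * Y + (3 - 2 * r) * X) / 4 := by
    linear_combination (3 + 2 * r) / 4 * hpY + (3 - 2 * r) / 4 * hpX
  rw [div_eq_iff hW, hWr, hn]
  have hcancel : ∀ N : ℝ, (N / (24 * (1 - (3 - 2 * r) ^ 2 * X ^ 2)) - 2 / 3 * n) *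
      ((4 + 3 * r) * Y / 4 * (1 - (3 - 2 * r) ^ 2 * X ^ 2)) =
      (N / 24 - 2 / 3 * n * (1 - (3 - 2 * r) ^ 2 * X ^ 2)) * ((4 + 3 * r) * Y / 4) := by
    intro N
    field_simp
  rw [hcancel]
  -- What is left is a polynomial identity modulo `r ^ 2 = 2` and `X * Y = 1`.
  grind

theorem theorem5p1 (n : ℕ) (α : ℝ) (hα : α = 3 - 2 * √2) :
    kirchhoffIndex (linearHexagonalChain n) =
      (1 + 2 * (n : ℝ)) *
          (21 - 6 * √2 + 2 * (8 + 9 * √2) * n -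
            α ^ (2 * n + 2) * (21 + 6 * √2 + 2 * (8 - 9 * √2) * n)) /
          (12 * (1 - α ^ (2 * n + 2))) +
        4 / 3 * (1 + 2 * (n : ℝ)) * (n : ℝ) ^ 2 := by
  subst hα
  rw [kirchhoffIndex_linearHexagonalChain, sum_pathGreen_rungWeight, mul_comm 12, mul_comm 24, ← div_div _ _ (24 : ℝ),
    ← div_div _ _ (12 : ℝ), mul_div_assoc (1 + 2 * (n : ℝ))]
  ring
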